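/- **Theorem (simulation of Hermitian polynomials).** There is an absolute constant $C>0$ such that the following holds. Let $\mathcal H_{\mathsf A}$ be a finite-dimensional Hilbert space, $K\in\mathbb N$, $R$ a finite set of strings over the alphabet $\{1,\dots,K\}$, $c_r,\phi_r\in\mathbb R$ for $r\in R$, $t\in\mathbb R$ and $\delta>0$. For states (density matrices) $\rho_1,\dots,\rho_K$ on $\mathcal H_{\mathsf A}$ put $$H=\sum_{r\in R}c_rH_r,\qquad H_r=\tfrac12\left(e^{i\phi_r}\rho_{r_1}\rho_{r_2}\cdots\rho_{r_{|r|}}+e^{-i\phi_r}\rho_{r_{|r|}}\rho_{r_{|r|-1}}\cdots\rho_{r_1}\right),$$ and let $c=\sum_{r\in R}|c_r|$, $L=\max_{r\in R}|r|$ (with $L=0$ if $R=\emptyset$), $\kappa_j=\sum_{r\in R}v_j(r)|c_r|/c$ (with $\kappa_j=0$ if $c=0$), where $v_j(r)=|\{s:r_s=j\}|$, and $$N=\left\lceil C\,c^2t^2/\delta\right\rceil .$$ Then there is a quantum algorithm, depending on $\mathcal H_{\mathsf A},K,R,(c_r),(\phi_r),t,\delta$ but not on the unknown states, which, given samples of $\rho_1,\dots,\rho_K$,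 acts on a system $\mathsf A$ with the following properties. 1. For all states $\rho_1,\dots,\rho_K$ on $\mathcal H_{\mathsf A}$, every finite-dimensional Hilbert space $\mathcal H_{\mathsf B}$ and every state $\sigma_{\mathsf{AB}}$ on $\mathcal H_{\mathsf A}\otimes\mathcal H_{\mathsf B}$, the algorithm applied to the subsystem $\mathsf A$ of $\sigma_{\mathsf{AB}}$ yields a state $\tilde\sigma_{\mathsf{AB}}$ with $$\tfrac12\left\|(e^{-iHt}\otimes\mathbb 1_{\mathsf B})\,\sigma_{\mathsf{AB}}\,(e^{iHt}\otimes\mathbb 1_{\mathsf B})-\tilde\sigma_{\mathsf{AB}}\right\|_1\le\delta .$$ 2. The algorithm never uses more than $LN$ samples in total; so it uses $O(Lc^2t^2/\delta)$ samples as soon as $c^2t^2/\delta$ is bounded away from $0$. 3. For each $j$ the expected number of samples of $\rho_j$ that it uses is at most $\kappa_jN$, that is, $O(\kappa_jc^2t^2/\delta)$ under the same proviso. Here a quantum algorithm using samples is a finite probability distribution over pairs consisting of a finite list of labels $\ell_1,\dots,\ell_n\in\{1,\dots,K\}$ and a quantum channel (completely positive trace-preserving map) that takes $\mathsf A$ together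 with the samples $\rho_{\ell_1}\otimes\cdots\otimes\rho_{\ell_n}$ to $\mathsf A$; expectations are over this distribution. -/

import Mathlib

open scoped Kronecker ComplexOrder

/-- A density matrix (quantum state): positive semidefinite of trace one.  A finite-dimensional
Hilbert space is represented by the finite set indexing one of its orthonormal bases. -/
def IsDensityMatrix {a : Type} [Fintype a] (ρ : Matrix a a ℂ) : Prop :=
  ρ.PosSemidef ∧ ρ.trace = 1

open scoped MatrixOrder in
/-- The trace norm `‖M‖₁ = Tr √(M M†)`. -/
noncomputable def traceNorm {a : Type} [Fintype a] [DecidableEq a] (M : Matrix a a ℂ) : ℝ :=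
  (CFC.sqrt (M * M.conjTranspose)).trace.re

/-- The map `Φ ⊗ id` on the space `a ⊗ e`, obtained from a linear map `Φ` on operators on `a`:
`Φ` acts on each of the blocks indexed by a pair of basis elements of `e`. -/
def tensorId {a b : Type} (Φ : Matrix a a ℂ →ₗ[ℂ] Matrix b b ℂ) (e : Type)
    (X : Matrix (a × e) (a × e) ℂ) : Matrix (b × e) (b × e) ℂ :=
  Matrix.of fun p q => Φ (Matrix.of fun x y => X (x, p.2) (y, q.2)) p.1 q.1

/-- A quantum channel: a completely positive trace-preserving linear map. -/
def IsQuantumChannel {a b : Type} [Fintype a] [Fintype b]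
    (Φ : Matrix a a ℂ →ₗ[ℂ] Matrix b b ℂ) : Prop :=
  (∀ (m : ℕ) (X : Matrix (a × Fin m) (a × Fin m) ℂ),
      X.PosSemidef → (tensorId Φ (Fin m) X).PosSemidef) ∧
    ∀ X : Matrix a a ℂ, (Φ X).trace = X.trace

/-- A quantum algorithm acting on one system `A` and consuming samples of `K` unknown states on
copies of `A`.  It first tosses a classical coin with finitely many outcomes; given the outcome `ω`
it requests `samples ω` samples, the `i`-th one being a sample of the state number `label ω i`;
then it applies a fixed quantum channel to `A` together with all requested samples, and this channel
returns a state of `A` (everything else having been discarded). -/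
structure SampleAlgorithm (A : Type) [Fintype A] [DecidableEq A] (K : ℕ) where
  Outcome : Type
  [fintypeOutcome : Fintype Outcome]
  prob : Outcome → ℝ
  prob_nonneg : ∀ ω, 0 ≤ prob ω
  prob_sum : ∑ ω, prob ω = 1
  samples : Outcome → ℕ
  label : (ω : Outcome) → Fin (samples ω) → Fin K
  channel : (ω : Outcome) →
    Matrix (A × (Fin (samples ω) → A)) (A × (Fin (samples ω) → A)) ℂ →ₗ[ℂ] Matrix A A ℂ
  isQuantumChannel : ∀ ω, IsQuantumChannel (channel ω)

attribute [instance] SampleAlgorithm.fintypeOutcome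

/-- The state `σ_{AB} ⊗ ρ_{ℓ(1)} ⊗ ⋯ ⊗ ρ_{ℓ(n)}`, with the registers arranged in the order
(`A`, the `n` samples, `B`). -/
def jointState {A B : Type} {K n : ℕ} (ρ : Fin K → Matrix A A ℂ) (l : Fin n → Fin K)
    (σ : Matrix (A × B) (A × B) ℂ) :
    Matrix ((A × (Fin n → A)) × B) ((A × (Fin n → A)) × B) ℂ :=
  Matrix.of fun p q =>
    σ (p.1.1, p.2) (q.1.1, q.2) * ∏ i, ρ (l i) (p.1.2 i) (q.1.2 i)

/-- The state of `AB` after the algorithm has been run on the subsystem `A` of `σ_{AB}`, with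
samples of the states `ρ j`; nothing is done to `B`. -/
noncomputable def SampleAlgorithm.output {A B : Type} [Fintype A] [DecidableEq A] {K : ℕ}
    (P : SampleAlgorithm A K) (ρ : Fin K → Matrix A A ℂ) (σ : Matrix (A × B) (A × B) ℂ) :
    Matrix (A × B) (A × B) ℂ :=
  ∑ ω, (P.prob ω : ℂ) • tensorId (P.channel ω) B (jointState ρ (P.label ω) σ)

/-- The average number of samples of the `j`-th state that the algorithm consumes. -/
noncomputable def SampleAlgorithm.averageUses {A : Type} [Fintype A] [DecidableEq A] {K : ℕ}
    (P : SampleAlgorithm A K) (j : Fin K) : ℝ :=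
  ∑ ω, P.prob ω * (Finset.univ.filter fun i => P.label ω i = j).card

/-- `H_r = (e^{iφ} ρ_{r_1} ⋯ ρ_{r_k} + e^{-iφ} ρ_{r_k} ⋯ ρ_{r_1}) / 2` for the string `r`. -/
noncomputable def hermitianMonomial {A : Type} [Fintype A] [DecidableEq A] {K : ℕ}
    (ρ : Fin K → Matrix A A ℂ) (φ : ℝ) (r : List (Fin K)) : Matrix A A ℂ :=
  (1 / 2 : ℂ) • (Complex.exp (Complex.I * φ) • (r.map ρ).prod +
    Complex.exp (-(Complex.I * φ)) • (r.reverse.map ρ).prod)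

/-- `H = ∑_{r ∈ R} c_r H_r`. -/
noncomputable def hermitianPolynomial {A : Type} [Fintype A] [DecidableEq A] {K : ℕ}
    (R : Finset (List (Fin K))) (c φ : List (Fin K) → ℝ) (ρ : Fin K → Matrix A A ℂ) :
    Matrix A A ℂ :=
  ∑ r ∈ R, (c r : ℂ) • hermitianMonomial ρ (φ r) r

/-- `c = ∑_{r ∈ R} |c_r|`. -/
def coeffSum {K : ℕ} (R : Finset (List (Fin K))) (c : List (Fin K) → ℝ) : ℝ :=
  ∑ r ∈ R, |c r|

/-- `L = max_{r ∈ R} |r|`. -/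
def polyDegree {K : ℕ} (R : Finset (List (Fin K))) : ℕ :=
  R.sup List.length

/-- `κ_j = ∑_{r ∈ R} v_j(r) |c_r| / c`, where `v_j(r)` is the number of occurrences of `j` in `r`. -/
noncomputable def averageMultiplicity {K : ℕ} (R : Finset (List (Fin K))) (c : List (Fin K) → ℝ)
    (j : Fin K) : ℝ :=
  ∑ r ∈ R, (r.count j : ℝ) * |c r| / coeffSum R c

/-- `e^{-iHt}`. -/
noncomputable def evolution {A : Type} [Fintype A] [DecidableEq A] (H : Matrix A A ℂ) (t : ℝ) :
    Matrix A A ℂ :=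
  NormedSpace.exp ((-(Complex.I * t)) • H)

/-- `(e^{-iHt} ⊗ 1) σ_{AB} (e^{iHt} ⊗ 1)`. -/
noncomputable def evolvedState {A B : Type} [Fintype A] [DecidableEq A] [Fintype B] [DecidableEq B]
    (H : Matrix A A ℂ) (t : ℝ) (σ : Matrix (A × B) (A × B) ℂ) : Matrix (A × B) (A × B) ℂ :=
  (evolution H t ⊗ₖ (1 : Matrix B B ℂ)) * σ * (evolution H (-t) ⊗ₖ (1 : Matrix B B ℂ))

open scoped Matrix.Norms.L2Operator
set_option linter.unusedSectionVars false

/-! The time `t` is cut into `N` steps of length `τ = t / N`. In one step a string `r` is drawn with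
probability `|c_r| / c`; the system and `|r|` samples, in the states named by `r`, evolve under `G =
(e^{iφ} S + e^{-iφ} S†) / 2` for time `sign(c_r) c τ`, where `S` is a cyclic shift of registers, and
the samples are then discarded.

The point is that tracing out the samples turns `S (σ ⊗ ρ_{r_1} ⊗ ⋯)` into `ρ_{r_1} ⋯ ρ_{r_k} σ`,
and `S†` into the reversed product (`traceMiddle_cyclicShift_mul_jointState` and its inverse
version). Hence `[G, ·]` reduces to `[H_r, ·]` on `σ` (`traceMiddle_commutator`), and averaging over
`r` gives exactly the first-order term `-iτ[H, σ]` of the true evolution. As `‖G‖ ≤ 1` and `‖H‖ ≤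
c`, both second-order remainders are at most `4 (cτ)²` in trace norm
(`TraceBounded.conj_remainder`), so one step errs by at most `8 (cτ)²`
(`traceBounded_simulationStep`). Errors add up over the steps to `8 c²t² / N`, half of which is at
most `δ` once `N ≥ 4 c²t² / δ`.

A step uses at most `L` samples, and `κ_j` samples of `ρ_j` on average; both counts scale with `N`.

Trace-norm estimates are made in the dual form `TraceBounded`, where the triangle inequality and the
effect of multiplications and partial traces are immediate; `TraceBounded.traceNorm_le` converts the
final bound. -/

/-- The trace norm of `X` is at most `t`, expressed by duality with the operator norm. -/
def TraceBounded {a : Type} [Fintype a] [DecidableEq a] (X : Matrix a a ℂ) (t : ℝ) : Prop :=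
  ∀ W : Matrix a a ℂ, ‖(W * X).trace‖ ≤ t * ‖W‖

/-! ### Trace-norm bounds by duality with the operator norm -/

section TraceBounded

variable {a b : Type} [Fintype a] [DecidableEq a] [Fintype b] [DecidableEq b]

-- Testing against the adjoint of the polar part, `W = X† D^{-1/2}` with `D = X X†`, attains the
-- trace norm: `Tr (W X) = Tr √D`, while `‖W‖ ≤ 1`.
open scoped MatrixOrder in
theorem TraceBounded.traceNorm_le {X : Matrix a a ℂ} {t : ℝ} (h : TraceBounded X t) (ht : 0 ≤ t) :
    traceNorm X ≤ t := by
  have hD : (X * X.conjTranspose).PosSemidef := Matrix.posSemidef_self_mul_conjTranspose X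
  have hD0 : 0 ≤ X * X.conjTranspose := Matrix.nonneg_iff_posSemidef.2 hD
  set D := X * X.conjTranspose with hDdef
  have hsa : IsSelfAdjoint D := hD.1
  have hspec : ∀ x ∈ spectrum ℝ D, 0 ≤ x := fun x hx => spectrum_nonneg_of_nonneg hD0 hx
  have hc : ∀ f : ℝ → ℝ, ContinuousOn f (spectrum ℝ D) := fun f =>
    (Matrix.finite_real_spectrum (A := D)).continuousOn f
  -- The convention `0⁻¹ = 0` makes this the pseudo-inverse square root, so `W` is a partial
  -- isometry and `X` need not be invertible.
  let f : ℝ → ℝ := fun x => (Real.sqrt x)⁻¹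
  have hfsa : (cfc f D).conjTranspose = cfc f D := cfc_predicate f D
  have hsqrt : CFC.sqrt D = cfc Real.sqrt D := by
    rw [CFC.sqrt_eq_real_sqrt D hD0, cfcₙ_eq_cfc]
  have hfD : cfc f D * D = cfc Real.sqrt D := by
    conv_lhs => rw [show cfc f D * D = cfc f D * cfc (fun x : ℝ => x) D by rw [cfc_id' ℝ D]]
    rw [← cfc_mul f (fun x => x) D (hc _) (hc _)]
    refine cfc_congr fun x hx => ?_
    have := Real.div_sqrt (x := x)
    simp only [f]
    rw [mul_comm, ← div_eq_mul_inv, this]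
  have hW : ‖X.conjTranspose * cfc f D‖ ≤ 1 := by
    have h1 : (X.conjTranspose * cfc f D).conjTranspose * (X.conjTranspose * cfc f D)
        = cfc (fun x => Real.sqrt x * f x) D := by
      rw [Matrix.conjTranspose_mul, hfsa, Matrix.conjTranspose_conjTranspose,
        cfc_mul Real.sqrt f D (hc _) (hc _), ← hfD, hDdef]
      simp only [Matrix.mul_assoc]
    have h2 : ‖cfc (fun x => Real.sqrt x * f x) D‖ ≤ 1 := by
      refine norm_cfc_le zero_le_one fun x hx => ?_
      simp only [f]
      by_cases h0 : Real.sqrt x = 0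
      · simp [h0]
      · simp [mul_inv_cancel₀ h0]
    have h3 := Matrix.l2_opNorm_conjTranspose_mul_self (X.conjTranspose * cfc f D)
    rw [h1] at h3
    nlinarith [norm_nonneg (X.conjTranspose * cfc f D)]
  have key := h (X.conjTranspose * cfc f D)
  have htr : (X.conjTranspose * cfc f D * X).trace = (CFC.sqrt D).trace := by
    rw [hsqrt, ← hfD, Matrix.trace_mul_comm, ← Matrix.mul_assoc, Matrix.trace_mul_comm]
  rw [htr] at key
  calc traceNorm X = (CFC.sqrt D).trace.re := rfl
    _ ≤ ‖(CFC.sqrt D).trace‖ := Complex.re_le_norm _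
    _ ≤ t * ‖X.conjTranspose * cfc f D‖ := key
    _ ≤ t * 1 := by gcongr
    _ = t := mul_one t

theorem TraceBounded.mono {X : Matrix a a ℂ} {s t : ℝ} (h : TraceBounded X s) (hst : s ≤ t) :
    TraceBounded X t :=
  fun W => (h W).trans (mul_le_mul_of_nonneg_right hst (norm_nonneg W))

theorem TraceBounded.zero : TraceBounded (0 : Matrix a a ℂ) 0 := fun W => by simp

theorem TraceBounded.add {X Y : Matrix a a ℂ} {s t : ℝ} (hX : TraceBounded X s)
    (hY : TraceBounded Y t) : TraceBounded (X + Y) (s + t) := fun W => by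
  rw [Matrix.mul_add, Matrix.trace_add, add_mul]
  exact (norm_add_le _ _).trans (add_le_add (hX W) (hY W))

theorem TraceBounded.smul {X : Matrix a a ℂ} {t : ℝ} (hX : TraceBounded X t) (z : ℂ) :
    TraceBounded (z • X) (‖z‖ * t) := fun W => by
  rw [Matrix.mul_smul, Matrix.trace_smul, norm_smul, mul_assoc]
  exact mul_le_mul_of_nonneg_left (hX W) (norm_nonneg z)

theorem TraceBounded.neg {X : Matrix a a ℂ} {t : ℝ} (hX : TraceBounded X t) :
    TraceBounded (-X) t := fun W => by
  rw [Matrix.mul_neg, Matrix.trace_neg, norm_neg]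
  exact hX W

theorem TraceBounded.sub {X Y : Matrix a a ℂ} {s t : ℝ} (hX : TraceBounded X s)
    (hY : TraceBounded Y t) : TraceBounded (X - Y) (s + t) := by
  rw [sub_eq_add_neg]
  exact hX.add hY.neg

theorem TraceBounded.sum {ι : Type} (s : Finset ι) {X : ι → Matrix a a ℂ} {t : ι → ℝ}
    (h : ∀ i ∈ s, TraceBounded (X i) (t i)) : TraceBounded (∑ i ∈ s, X i) (∑ i ∈ s, t i) :=
  fun W => by
    rw [Matrix.mul_sum, Matrix.trace_sum, Finset.sum_mul]
    exact norm_sum_le_of_le s fun i hi => h i hi W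

theorem TraceBounded.mul_mul {X : Matrix a a ℂ} {t u v : ℝ} (hX : TraceBounded X t) (ht : 0 ≤ t)
    {P Q : Matrix a a ℂ} (hP : ‖P‖ ≤ u) (hQ : ‖Q‖ ≤ v) :
    TraceBounded (P * X * Q) (u * v * t) := fun W => by
  have h1 : (W * (P * X * Q)).trace = (Q * W * P * X).trace := by
    rw [← Matrix.mul_assoc, Matrix.trace_mul_comm]
    simp only [Matrix.mul_assoc]
  rw [h1]
  have hu : 0 ≤ u := (norm_nonneg P).trans hP
  have hv : 0 ≤ v := (norm_nonneg Q).trans hQ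
  calc ‖(Q * W * P * X).trace‖ ≤ t * ‖Q * W * P‖ := hX _
    _ ≤ t * (v * ‖W‖ * u) := by
      gcongr
      refine (norm_mul_le _ _).trans ?_
      gcongr
      exact (norm_mul_le _ _).trans (by gcongr)
    _ = u * v * t * ‖W‖ := by ring

theorem Matrix.norm_apply_le_l2_opNorm (M : Matrix a a ℂ) (i j : a) : ‖M i j‖ ≤ ‖M‖ := by
  have h := Matrix.l2_opNorm_mulVec M (EuclideanSpace.single j 1)
  rw [PiLp.norm_single, norm_one, mul_one] at h
  refine le_trans ?_ h
  have h2 := PiLp.norm_apply_le (WithLp.toLp 2 (M.mulVec (EuclideanSpace.single j (1 : ℂ)))) i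
  simpa using h2

theorem Matrix.PosSemidef.exists_unitary_diagonal {X : Matrix a a ℂ} (hX : X.PosSemidef) :
    ∃ (U : Matrix a a ℂ) (d : a → ℝ), U ∈ unitary (Matrix a a ℂ) ∧ (∀ i, 0 ≤ d i) ∧
      X = U * Matrix.diagonal (fun i => (d i : ℂ)) * star U ∧ ∑ i, d i = X.trace.re := by
  refine ⟨hX.1.eigenvectorUnitary, hX.1.eigenvalues, hX.1.eigenvectorUnitary.2,
    hX.eigenvalues_nonneg, ?_, ?_⟩
  · have := hX.1.spectral_theorem
    rw [Unitary.conjStarAlgAut_apply] at this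
    exact this
  · rw [hX.1.trace_eq_sum_eigenvalues]
    simp

theorem norm_le_one_of_mem_unitary {U : Matrix a a ℂ} (hU : U ∈ unitary (Matrix a a ℂ)) :
    ‖U‖ ≤ 1 := by
  -- On the zero space `‖1‖ = 0`, which is why only an inequality is claimed.
  rcases subsingleton_or_nontrivial (Matrix a a ℂ) with h | h
  · rw [Subsingleton.elim U 0, norm_zero]
    exact zero_le_one
  · exact (CStarRing.norm_of_mem_unitary hU).le

/-- In an eigenbasis of `X`, `Tr (W X)` is the sum of the eigenvalues weighted by diagonal entries
of `W`, each of modulus at most `‖W‖`. -/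
theorem TraceBounded.of_posSemidef {X : Matrix a a ℂ} (hX : X.PosSemidef) :
    TraceBounded X X.trace.re := fun W => by
  obtain ⟨U, d, hU, hd, hXd, htr⟩ := hX.exists_unitary_diagonal
  have h1 : (W * X).trace = ∑ i, (star U * W * U) i i * d i := by
    rw [hXd, ← Matrix.mul_assoc, Matrix.trace_mul_comm, ← Matrix.mul_assoc, ← Matrix.mul_assoc,
      Matrix.trace]
    simp [Matrix.mul_diagonal]
  rw [h1, ← htr, Finset.sum_mul]
  refine norm_sum_le_of_le _ fun i _ => ?_
  rw [norm_mul, Complex.norm_real, Real.norm_of_nonneg (hd i), mul_comm]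
  refine mul_le_mul_of_nonneg_left ((Matrix.norm_apply_le_l2_opNorm _ i i).trans ?_) (hd i)
  have hU1 := norm_le_one_of_mem_unitary hU
  have hU2 := norm_le_one_of_mem_unitary (Unitary.star_mem hU)
  calc ‖star U * W * U‖ ≤ ‖star U‖ * ‖W‖ * ‖U‖ :=
        (norm_mul_le _ _).trans (mul_le_mul_of_nonneg_right (norm_mul_le _ _) (norm_nonneg _))
    _ ≤ 1 * ‖W‖ * 1 := by gcongr
    _ = ‖W‖ := by ring

theorem IsDensityMatrix.traceBounded {X : Matrix a a ℂ} (hX : IsDensityMatrix X) :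
    TraceBounded X 1 := by
  have := TraceBounded.of_posSemidef hX.1
  rwa [hX.2, Complex.one_re] at this

theorem IsDensityMatrix.norm_le_one {X : Matrix a a ℂ} (hX : IsDensityMatrix X) : ‖X‖ ≤ 1 := by
  obtain ⟨U, d, hU, hd, hXd, htr⟩ := hX.1.exists_unitary_diagonal
  rw [hX.2, Complex.one_re] at htr
  have hD : ‖Matrix.diagonal (fun i => (d i : ℂ))‖ ≤ 1 := by
    rw [Matrix.l2_opNorm_diagonal, pi_norm_le_iff_of_nonneg zero_le_one]
    intro i
    rw [Complex.norm_real, Real.norm_of_nonneg (hd i), ← htr]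
    exact Finset.single_le_sum (fun j _ => hd j) (Finset.mem_univ i)
  have hU1 := norm_le_one_of_mem_unitary hU
  have hU2 := norm_le_one_of_mem_unitary (Unitary.star_mem hU)
  calc ‖X‖ ≤ ‖U‖ * ‖Matrix.diagonal (fun i => (d i : ℂ))‖ * ‖star U‖ := by
        conv_lhs => rw [hXd]
        exact (norm_mul_le _ _).trans (mul_le_mul_of_nonneg_right (norm_mul_le _ _) (norm_nonneg _))
    _ ≤ 1 * 1 * 1 := by gcongr
    _ = 1 := by norm_num

/-- `M ↦ M ⊗ 1`. -/
noncomputable def kroneckerOne (a b : Type) [Fintype a] [DecidableEq a] [Fintype b]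
    [DecidableEq b] : Matrix a a ℂ →⋆ₐ[ℂ] Matrix (a × b) (a × b) ℂ where
  toFun M := M ⊗ₖ (1 : Matrix b b ℂ)
  map_one' := Matrix.one_kronecker_one
  map_mul' M N := by rw [← Matrix.mul_kronecker_mul, Matrix.mul_one]
  map_zero' := Matrix.zero_kronecker _
  map_add' M N := Matrix.add_kronecker _ _ _
  commutes' z := by
    rw [Algebra.algebraMap_eq_smul_one, Algebra.algebraMap_eq_smul_one, Matrix.smul_kronecker,
      Matrix.one_kronecker_one]
  map_star' M := by
    rw [Matrix.star_eq_conjTranspose, Matrix.star_eq_conjTranspose,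
      Matrix.conjTranspose_kronecker, Matrix.conjTranspose_one]

theorem kroneckerOne_apply (M : Matrix a a ℂ) :
    kroneckerOne a b M = M ⊗ₖ (1 : Matrix b b ℂ) := rfl

/-- A star homomorphism of C*-algebras is contractive. -/
theorem norm_kroneckerOne_le (M : Matrix a a ℂ) : ‖kroneckerOne a b M‖ ≤ ‖M‖ :=
  NonUnitalStarAlgHom.norm_apply_le (kroneckerOne a b) M

end TraceBounded

/-- The tail of the series from order two is dominated termwise by that of the real number `e^g`,
for which the bound is known. -/
theorem NormedSpace.norm_exp_sub_one_sub_id_le {𝔸 : Type*} [NormedRing 𝔸] [NormedAlgebra ℂ 𝔸]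
    [CompleteSpace 𝔸] {x : 𝔸} {g : ℝ} (hx : ‖x‖ ≤ g) (hg : g ≤ 1) :
    ‖NormedSpace.exp x - 1 - x‖ ≤ g ^ 2 := by
  have hg0 : 0 ≤ g := (norm_nonneg x).trans hx
  have h1 := (hasSum_nat_add_iff' 2).2 (NormedSpace.exp_series_hasSum_exp' (𝕂 := ℂ) x)
  have h2 := (hasSum_nat_add_iff' 2).2 (NormedSpace.exp_series_hasSum_exp' (𝕂 := ℝ) g)
  have hle : ∀ n : ℕ, ‖((n + 2).factorial⁻¹ : ℂ) • x ^ (n + 2)‖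
      ≤ ((n + 2).factorial⁻¹ : ℝ) • g ^ (n + 2) := fun n => by
    rw [norm_smul, norm_inv, Complex.norm_natCast, smul_eq_mul]
    gcongr
    exact (norm_pow_le' x (by omega)).trans (pow_le_pow_left₀ (norm_nonneg x) hx _)
  have h3 := h1.tsum_eq ▸ tsum_of_norm_bounded h2 hle
  have h4 := Real.abs_exp_sub_one_sub_id_le (x := g) (by rwa [abs_of_nonneg hg0])
  rw [← Real.exp_eq_exp_ℝ] at h3
  simp only [Finset.sum_range_succ, Finset.sum_range_zero] at h3
  simp only [Nat.factorial, pow_zero, pow_one, zero_add] at h3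
  norm_num at h3
  rw [← sub_sub, ← sub_sub] at h3
  exact h3.trans ((le_abs_self _).trans h4)

/-! ### Unitary evolution and its second-order remainder -/

section Evolution

variable {a b : Type} [Fintype a] [DecidableEq a] [Fintype b] [DecidableEq b]

/-- Second-order remainder of a conjugation close to the identity. -/
theorem TraceBounded.conj_remainder {V V' A X : Matrix a a ℂ} {g : ℝ} (hV : ‖V‖ ≤ 1)
    (hV' : ‖V'‖ ≤ 1) (hA : ‖A‖ ≤ g) (hE : g ≤ 1 → ‖V - 1 - A‖ ≤ g ^ 2)
    (hE' : g ≤ 1 → ‖V' - 1 + A‖ ≤ g ^ 2) (hX : TraceBounded X 1) :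
    TraceBounded (V * X * V' - X - (A * X - X * A)) (4 * g ^ 2) := by
  have hg0 : 0 ≤ g := (norm_nonneg A).trans hA
  have h1 : ‖(1 : Matrix a a ℂ)‖ ≤ 1 := norm_le_one_of_mem_unitary (one_mem _)
  -- For small `g`, expanding around `1 + A` and `1 - A` leaves four terms, bounded by `g² + g² + g³
  -- + g² ≤ 4g²`. For `g ≥ 1` the crude bound `2 + 2g ≤ 4g²` suffices, so no smallness of the step
  -- is ever required.
  rcases le_total g 1 with hg | hg
  · have e1 := hX.mul_mul zero_le_one (hE hg) hV'
    have e2 := hX.mul_mul zero_le_one h1 (hE' hg)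
    have e3 := hX.mul_mul zero_le_one hA (hE' hg)
    have e4 := hX.mul_mul zero_le_one hA hA
    have := ((e1.add e2).add e3).sub e4
    have heq : V * X * V' - X - (A * X - X * A) = (V - 1 - A) * X * V' + 1 * X * (V' - 1 + A)
        + A * X * (V' - 1 + A) - A * X * A := by noncomm_ring
    rw [heq]
    refine this.mono ?_
    nlinarith [mul_nonneg hg0 (sq_nonneg g), mul_le_mul_of_nonneg_right hg (sq_nonneg g)]
  · have e1 := hX.mul_mul zero_le_one hV hV'
    have e2 := hX.mul_mul zero_le_one hA h1
    have e3 := hX.mul_mul zero_le_one h1 hA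
    have := (e1.sub hX).sub (e2.sub e3)
    rw [Matrix.mul_one, Matrix.one_mul] at this
    exact this.mono (by nlinarith)

theorem evolution_add (H : Matrix a a ℂ) (s t : ℝ) :
    evolution H (s + t) = evolution H s * evolution H t := by
  unfold evolution
  rw [← Matrix.exp_add_of_commute _ _ (((Commute.refl H).smul_left _).smul_right _), ← add_smul]
  push_cast
  ring_nf

theorem evolution_zero (H : Matrix a a ℂ) : evolution H 0 = 1 := by
  simp [evolution]

theorem star_evolution {H : Matrix a a ℂ} (hH : H.IsHermitian) (t : ℝ) :
    star (evolution H t) = evolution H (-t) := by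
  unfold evolution
  rw [NormedSpace.star_exp, star_smul, Matrix.star_eq_conjTranspose, hH.eq]
  simp

theorem evolution_mem_unitary {H : Matrix a a ℂ} (hH : H.IsHermitian) (t : ℝ) :
    evolution H t ∈ unitary (Matrix a a ℂ) := by
  rw [Unitary.mem_iff, star_evolution hH, ← evolution_add, ← evolution_add]
  simp [evolution_zero]

theorem evolvedState_eq (H : Matrix a a ℂ) (t : ℝ) (σ : Matrix (a × b) (a × b) ℂ) :
    evolvedState H t σ
      = kroneckerOne a b (evolution H t) * σ * kroneckerOne a b (evolution H (-t)) := rfl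

theorem evolvedState_add (H : Matrix a a ℂ) (s t : ℝ) (σ : Matrix (a × b) (a × b) ℂ) :
    evolvedState H (s + t) σ = evolvedState H s (evolvedState H t σ) := by
  simp only [evolvedState_eq]
  rw [evolution_add, show -(s + t) = -t + -s by ring, evolution_add, map_mul, map_mul]
  simp only [Matrix.mul_assoc]

theorem evolvedState_zero (H : Matrix a a ℂ) (σ : Matrix (a × b) (a × b) ℂ) :
    evolvedState H 0 σ = σ := by
  simp [evolvedState_eq, evolution_zero]

theorem evolvedState_zero_left (t : ℝ) (σ : Matrix (a × b) (a × b) ℂ) :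
    evolvedState (0 : Matrix a a ℂ) t σ = σ := by
  simp [evolvedState_eq, evolution]

theorem evolvedState_sub (H : Matrix a a ℂ) (t : ℝ) (σ τ : Matrix (a × b) (a × b) ℂ) :
    evolvedState H t (σ - τ) = evolvedState H t σ - evolvedState H t τ := by
  simp only [evolvedState_eq, Matrix.mul_sub, Matrix.sub_mul]

theorem norm_kroneckerOne_evolution_le {H : Matrix a a ℂ} (hH : H.IsHermitian) (t : ℝ) :
    ‖kroneckerOne a b (evolution H t)‖ ≤ 1 :=
  (norm_kroneckerOne_le _).trans (norm_le_one_of_mem_unitary (evolution_mem_unitary hH t))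

theorem TraceBounded.evolvedState {H : Matrix a a ℂ} (hH : H.IsHermitian) (t : ℝ)
    {X : Matrix (a × b) (a × b) ℂ} {s : ℝ} (hs : 0 ≤ s) (hX : TraceBounded X s) :
    TraceBounded (evolvedState H t X) s := by
  have := hX.mul_mul hs (norm_kroneckerOne_evolution_le (b := b) hH t)
    (norm_kroneckerOne_evolution_le (b := b) hH (-t))
  rwa [one_mul, one_mul] at this

theorem evolution_remainder {H : Matrix a a ℂ} {t g : ℝ} (hg : |t| * ‖H‖ ≤ g) (hg1 : g ≤ 1) :
    ‖evolution H t - 1 - (-(Complex.I * t)) • H‖ ≤ g ^ 2 :=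
  NormedSpace.norm_exp_sub_one_sub_id_le (by
    rw [norm_smul, norm_neg, norm_mul, Complex.norm_I, one_mul, Complex.norm_real]
    exact hg) hg1

theorem TraceBounded.evolvedState_remainder {H : Matrix a a ℂ} (hH : H.IsHermitian) {t g : ℝ}
    (hg : |t| * ‖H‖ ≤ g) {X : Matrix (a × b) (a × b) ℂ} (hX : TraceBounded X 1) :
    TraceBounded (_root_.evolvedState H t X - X
      - (-(Complex.I * t)) • (kroneckerOne a b H * X - X * kroneckerOne a b H)) (4 * g ^ 2) := by
  have h := hX.conj_remainder (g := g) (norm_kroneckerOne_evolution_le (b := b) hH t)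
    (norm_kroneckerOne_evolution_le (b := b) hH (-t))
    (A := kroneckerOne a b ((-(Complex.I * t)) • H)) ?_ ?_ ?_
  · rw [map_smul, Matrix.smul_mul, Matrix.mul_smul, ← smul_sub] at h
    exact h
  · refine (norm_kroneckerOne_le _).trans ?_
    rw [norm_smul, norm_neg, norm_mul, Complex.norm_I, one_mul, Complex.norm_real]
    exact hg
  · intro hg1
    rw [← map_one (kroneckerOne a b), ← map_sub, ← map_sub]
    exact (norm_kroneckerOne_le _).trans (evolution_remainder hg hg1)
  · intro hg1
    rw [← map_one (kroneckerOne a b), ← map_sub, ← map_add]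
    refine (norm_kroneckerOne_le _).trans ?_
    have := evolution_remainder (H := H) (t := -t) (by rwa [abs_neg]) hg1
    push_cast at this
    rwa [mul_neg, neg_neg, sub_eq_add_neg _ ((Complex.I * (t : ℂ)) • H), ← neg_smul] at this

end Evolution

/-! ### Cyclic shifts, partial traces and matrix products -/

section CyclicShift

variable {A B : Type} [Fintype A] [DecidableEq A] [Fintype B] [DecidableEq B]

/-- The cyclic shift of the registers `A` and `k` copies of `A`. -/
def cyclicShift (A : Type) (k : ℕ) : Equiv.Perm (A × (Fin k → A)) where
  toFun p := ((Fin.cons p.1 p.2 : Fin (k + 1) → A) (Fin.last k),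
    fun i => (Fin.cons p.1 p.2 : Fin (k + 1) → A) i.castSucc)
  invFun q := ((Fin.snoc q.2 q.1 : Fin (k + 1) → A) 0,
    fun i => (Fin.snoc q.2 q.1 : Fin (k + 1) → A) i.succ)
  left_inv p := by
    have h : (Fin.snoc (fun i => (Fin.cons p.1 p.2 : Fin (k + 1) → A) i.castSucc)
        ((Fin.cons p.1 p.2 : Fin (k + 1) → A) (Fin.last k)) : Fin (k + 1) → A)
        = Fin.cons p.1 p.2 := Fin.snoc_init_self _
    simp only [h, Fin.cons_zero, Fin.cons_succ]
  right_inv q := by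
    have h : (Fin.cons ((Fin.snoc q.2 q.1 : Fin (k + 1) → A) 0)
        (fun i => (Fin.snoc q.2 q.1 : Fin (k + 1) → A) i.succ) : Fin (k + 1) → A)
        = Fin.snoc q.2 q.1 := Fin.cons_self_tail _
    simp only [h, Fin.snoc_castSucc, Fin.snoc_last]

theorem sum_fin_cons {k : ℕ} {A : Type} [Fintype A] (f : (Fin (k + 1) → A) → ℂ) :
    ∑ z, f z = ∑ x : A, ∑ z : Fin k → A, f (Fin.cons x z) := by
  rw [← (Fin.consEquiv fun _ => A).sum_comp, Fintype.sum_prod_type]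
  rfl

/-- The sum over paths `a → z_0 → ⋯ → z_{k-1}` is an entry of a matrix product expanded. Peeling off
the first factor moves the starting point, hence the induction for all `a`. -/
theorem sum_path_cons {k : ℕ} (ρ : Fin k → Matrix A A ℂ) (v : A → ℂ) (a : A) :
    ∑ z : Fin k → A, v ((Fin.cons a z : Fin (k + 1) → A) (Fin.last k)) *
        ∏ i, ρ i ((Fin.cons a z : Fin (k + 1) → A) i.castSucc) (z i)
      = ((List.ofFn ρ).prod.mulVec v) a := by
  induction k generalizing a with
  | zero => simp
  | succ k ih =>
    rw [sum_fin_cons, List.ofFn_succ,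
      List.prod_cons, ← Matrix.mulVec_mulVec, Matrix.mulVec, dotProduct]
    refine Finset.sum_congr rfl fun x _ => ?_
    rw [← ih, Finset.mul_sum]
    refine Finset.sum_congr rfl fun z _ => ?_
    rw [Fin.prod_univ_succ]
    simp only [← Fin.succ_last, Fin.cons_succ, Fin.castSucc_zero,
      Fin.cons_zero, ← Fin.succ_castSucc]
    ring

/-- Here the path ends at `a`, so the factors multiply in reverse. Summing over `z_0` replaces `v`
by the image of `v` under `ρ 0`, hence the induction for all `v`. -/
theorem sum_path_snoc {k : ℕ} (ρ : Fin k → Matrix A A ℂ) (v : A → ℂ) (a : A) :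
    ∑ z : Fin k → A, v ((Fin.snoc z a : Fin (k + 1) → A) 0) *
        ∏ i, ρ i ((Fin.snoc z a : Fin (k + 1) → A) i.succ) (z i)
      = ((List.ofFn ρ).reverse.prod.mulVec v) a := by
  induction k generalizing v with
  | zero => simp [Fin.snoc]
  | succ k ih =>
    rw [sum_fin_cons, Finset.sum_comm,
      List.ofFn_succ, List.reverse_cons, List.prod_append, List.prod_singleton,
      ← Matrix.mulVec_mulVec, ← ih]
    refine Finset.sum_congr rfl fun z _ => ?_
    rw [Matrix.mulVec, dotProduct, Finset.sum_mul]
    refine Finset.sum_congr rfl fun x _ => ?_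
    have h : (Fin.snoc (Fin.cons x z : Fin (k + 1) → A) a : Fin (k + 2) → A)
        = Fin.cons x (Fin.snoc z a : Fin (k + 1) → A) :=
      (Fin.cons_snoc_eq_snoc_cons (β := A) x z a).symm
    rw [Fin.prod_univ_succ, h]
    simp only [Fin.cons_succ, Fin.cons_zero]
    ring

/-- The partial trace over the second of three registers. -/
def traceMiddle {A Z B : Type} [Fintype Z] (X : Matrix ((A × Z) × B) ((A × Z) × B) ℂ) :
    Matrix (A × B) (A × B) ℂ :=
  Matrix.of fun p q => ∑ z, X ((p.1, z), p.2) ((q.1, z), q.2)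

section traceMiddle

variable {Z : Type} [Fintype Z] [DecidableEq Z]

theorem traceMiddle_sub (X Y : Matrix ((A × Z) × B) ((A × Z) × B) ℂ) :
    traceMiddle (X - Y) = traceMiddle X - traceMiddle Y := by
  ext p q
  simp [traceMiddle]

theorem traceMiddle_add (X Y : Matrix ((A × Z) × B) ((A × Z) × B) ℂ) :
    traceMiddle (X + Y) = traceMiddle X + traceMiddle Y := by
  ext p q
  simp [traceMiddle, Finset.sum_add_distrib]

theorem traceMiddle_smul (z : ℂ) (X : Matrix ((A × Z) × B) ((A × Z) × B) ℂ) :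
    traceMiddle (z • X) = z • traceMiddle X := by
  ext p q
  simp [traceMiddle, Finset.mul_sum]

theorem traceMiddle_conjTranspose (X : Matrix ((A × Z) × B) ((A × Z) × B) ℂ) :
    traceMiddle X.conjTranspose = (traceMiddle X).conjTranspose := by
  ext p q
  simp [traceMiddle]

theorem kroneckerOne_mul_apply (M : Matrix A A ℂ) {n : Type} (X : Matrix (A × B) n ℂ)
    (p : A × B) (q : n) :
    ((M ⊗ₖ (1 : Matrix B B ℂ)) * X) p q = ∑ x, M p.1 x * X (x, p.2) q := by
  simp [Matrix.mul_apply, Fintype.sum_prod_type, Matrix.one_apply, mul_ite, ite_mul]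

/-- Reordering the basis of a matrix algebra. -/
def submatrixStarAlgHom {m n : Type} [Fintype m] [DecidableEq m] [Fintype n] [DecidableEq n]
    (e : m ≃ n) : Matrix n n ℂ →⋆ₐ[ℂ] Matrix m m ℂ where
  toFun M := M.submatrix e e
  map_one' := Matrix.submatrix_one_equiv e
  map_mul' M N := (Matrix.submatrix_mul_equiv M N e e e).symm
  map_zero' := rfl
  map_add' M N := rfl
  commutes' z := by
    rw [Algebra.algebraMap_eq_smul_one, Algebra.algebraMap_eq_smul_one, Matrix.submatrix_smul]
    exact congrArg (fun M : Matrix m m ℂ => z • M) (Matrix.submatrix_one_equiv e)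
  map_star' M := rfl

/-- The partial trace is dual to `W ↦ W ⊗ 1`, which does not increase the operator norm. The
reordering `e` puts the discarded register last so that this tensor product can be formed. -/
theorem TraceBounded.traceMiddle {X : Matrix ((A × Z) × B) ((A × Z) × B) ℂ} {t : ℝ}
    (ht : 0 ≤ t) (hX : TraceBounded X t) : TraceBounded (_root_.traceMiddle X) t := fun W => by
  let e : (A × Z) × B ≃ (A × B) × Z :=
    ⟨fun p => ((p.1.1, p.2), p.1.2), fun p => ((p.1.1, p.2), p.1.2), fun _ => rfl, fun _ => rfl⟩
  have h : (W * _root_.traceMiddle X).trace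
      = (submatrixStarAlgHom e (kroneckerOne (A × B) Z W) * X).trace := by
    have h1 : submatrixStarAlgHom e (kroneckerOne (A × B) Z W) * X
        = submatrixStarAlgHom e ((W ⊗ₖ (1 : Matrix Z Z ℂ)) * X.submatrix e.symm e.symm) := by
      rw [map_mul, kroneckerOne_apply]
      congr 1
    have h2 : (submatrixStarAlgHom e ((W ⊗ₖ (1 : Matrix Z Z ℂ)) * X.submatrix e.symm e.symm)).trace
        = ∑ p, ∑ z, ((W ⊗ₖ (1 : Matrix Z Z ℂ)) * X.submatrix e.symm e.symm) (p, z) (p, z) := by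
      rw [Matrix.trace, ← e.symm.sum_comp, Fintype.sum_prod_type]
      rfl
    rw [h1, h2, Matrix.trace]
    refine Finset.sum_congr rfl fun p _ => ?_
    simp only [Matrix.diag, Matrix.mul_apply (M := W), _root_.traceMiddle, Matrix.of_apply,
      Finset.mul_sum]
    rw [Finset.sum_comm]
    refine Finset.sum_congr rfl fun z _ => ?_
    exact (kroneckerOne_mul_apply W (X.submatrix e.symm e.symm) (p, z) (p, z)).symm
  rw [h]
  refine (hX _).trans (mul_le_mul_of_nonneg_left ?_ ht)
  exact (NonUnitalStarAlgHom.norm_apply_le (submatrixStarAlgHom e) _).trans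
    (norm_kroneckerOne_le W)

end traceMiddle

theorem traceMiddle_cyclicShift_mul_jointState {K k : ℕ} (ρ : Fin K → Matrix A A ℂ)
    (l : Fin k → Fin K) (σ : Matrix (A × B) (A × B) ℂ) :
    traceMiddle (kroneckerOne (A × (Fin k → A)) B ((cyclicShift A k).permMatrix ℂ)
        * jointState ρ l σ)
      = kroneckerOne A B (List.ofFn fun i => ρ (l i)).prod * σ := by
  ext p q
  rw [kroneckerOne_apply, kroneckerOne_apply, kroneckerOne_mul_apply]
  refine Eq.trans ?_ (sum_path_cons (fun i => ρ (l i)) (fun x => σ (x, p.2) q) p.1)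
  refine Finset.sum_congr rfl fun z _ => ?_
  -- A row of a permutation matrix has a single nonzero entry; what remains is the weight of one
  -- path.
  rw [kroneckerOne_mul_apply, Finset.sum_eq_single (cyclicShift A k (p.1, z))]
  · simp [Equiv.Perm.permMatrix, PEquiv.toMatrix_apply, jointState, cyclicShift]
  · intro y _ hy
    simp [Equiv.Perm.permMatrix, PEquiv.toMatrix_apply, hy.symm]
  · simp

theorem traceMiddle_cyclicShift_inv_mul_jointState {K k : ℕ} (ρ : Fin K → Matrix A A ℂ)
    (l : Fin k → Fin K) (σ : Matrix (A × B) (A × B) ℂ) :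
    traceMiddle (kroneckerOne (A × (Fin k → A)) B ((cyclicShift A k)⁻¹.permMatrix ℂ)
        * jointState ρ l σ)
      = kroneckerOne A B (List.ofFn fun i => ρ (l i)).reverse.prod * σ := by
  ext p q
  rw [kroneckerOne_apply, kroneckerOne_apply, kroneckerOne_mul_apply]
  refine Eq.trans ?_ (sum_path_snoc (fun i => ρ (l i)) (fun x => σ (x, p.2) q) p.1)
  refine Finset.sum_congr rfl fun z _ => ?_
  rw [kroneckerOne_mul_apply, Finset.sum_eq_single ((cyclicShift A k).symm (p.1, z))]
  · simp [Equiv.Perm.permMatrix, PEquiv.toMatrix_apply, jointState, cyclicShift, Equiv.Perm.inv_def]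
  · intro y _ hy
    simp [Equiv.Perm.permMatrix, PEquiv.toMatrix_apply, Equiv.Perm.inv_def, hy.symm]
  · simp

end CyclicShift

/-! ### Quantum channels -/

section Channels

variable {a b c e : Type} [Fintype a] [Fintype b] [Fintype c] [Fintype e]

theorem IsQuantumChannel.posSemidef_tensorId {Φ : Matrix a a ℂ →ₗ[ℂ] Matrix b b ℂ}
    (h : IsQuantumChannel Φ) {X : Matrix (a × e) (a × e) ℂ} (hX : X.PosSemidef) :
    (tensorId Φ e X).PosSemidef := by
  let f := Fintype.equivFin e
  have h1 := (h.1 _ _ (hX.submatrix (Prod.map id f.symm))).submatrix (Prod.map id f)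
  convert h1 using 1
  ext p q
  simp [tensorId]

/-- `Φ ⊗ id` as a linear map. -/
def tensorIdLinear (Φ : Matrix a a ℂ →ₗ[ℂ] Matrix b b ℂ) (e : Type) :
    Matrix (a × e) (a × e) ℂ →ₗ[ℂ] Matrix (b × e) (b × e) ℂ where
  toFun := tensorId Φ e
  map_add' X Y := by
    ext p q
    exact congrFun₂ (map_add Φ _ _) p.1 q.1
  map_smul' z X := by
    ext p q
    exact congrFun₂ (map_smul Φ z _) p.1 q.1

/-- A further ancilla merges with `e` into a single ancilla `e × Fin m` for `Φ`, and the trace is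
preserved on each diagonal block. -/
theorem IsQuantumChannel.tensorIdLinear {Φ : Matrix a a ℂ →ₗ[ℂ] Matrix b b ℂ}
    (h : IsQuantumChannel Φ) (e : Type) [Fintype e] : IsQuantumChannel (tensorIdLinear Φ e) := by
  refine ⟨fun m X hX => ?_, fun X => ?_⟩
  · have h1 := (h.posSemidef_tensorId (hX.submatrix (Equiv.prodAssoc a e (Fin m)).symm)).submatrix
      (Equiv.prodAssoc b e (Fin m))
    exact h1
  · simp only [Matrix.trace, Fintype.sum_prod_type]
    rw [Finset.sum_comm, Finset.sum_comm (γ := a)]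
    exact Finset.sum_congr rfl fun z _ => h.2 (Matrix.of fun x y => X (x, z) (y, z))

theorem IsQuantumChannel.comp {Ψ : Matrix b b ℂ →ₗ[ℂ] Matrix c c ℂ}
    {Φ : Matrix a a ℂ →ₗ[ℂ] Matrix b b ℂ} (hΨ : IsQuantumChannel Ψ) (hΦ : IsQuantumChannel Φ) :
    IsQuantumChannel (Ψ ∘ₗ Φ) :=
  ⟨fun m X hX => hΨ.1 m _ (hΦ.1 m X hX), fun X => (hΨ.2 _).trans (hΦ.2 X)⟩

/-- Relabelling of the basis. -/
def relabel (f : b ≃ a) : Matrix a a ℂ →ₗ[ℂ] Matrix b b ℂ where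
  toFun X := X.submatrix f f
  map_add' _ _ := rfl
  map_smul' _ _ := rfl

theorem isQuantumChannel_relabel (f : b ≃ a) : IsQuantumChannel (relabel f) :=
  ⟨fun _ _ hX => hX.submatrix (Prod.map f id), fun X => f.sum_comp fun i => X i i⟩

variable [DecidableEq a] [DecidableEq e] [DecidableEq b]

/-- Conjugation by `V`, followed by the partial trace over the second factor. -/
def conjTrace (V : Matrix (a × b) (a × b) ℂ) :
    Matrix (a × b) (a × b) ℂ →ₗ[ℂ] Matrix a a ℂ where
  toFun X := Matrix.of fun x y => ∑ z, (V * X * V.conjTranspose) (x, z) (y, z)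
  map_add' X Y := by
    ext x y
    simp [Matrix.mul_add, Matrix.add_mul, Finset.sum_add_distrib]
  map_smul' z X := by
    ext x y
    simp [Finset.mul_sum]

theorem mul_kroneckerOne_apply {n : Type} (M : Matrix a a ℂ) (X : Matrix n (a × e) ℂ)
    (p : n) (q : a × e) :
    (X * (M ⊗ₖ (1 : Matrix e e ℂ))) p q = ∑ x, X p (x, q.2) * M x q.1 := by
  simp [Matrix.mul_apply, Fintype.sum_prod_type, Matrix.one_apply, mul_ite]

theorem tensorId_conjTrace (V : Matrix (a × b) (a × b) ℂ)
    (X : Matrix ((a × b) × e) ((a × b) × e) ℂ) :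
    tensorId (conjTrace V) e X
      = traceMiddle (kroneckerOne (a × b) e V * X * kroneckerOne (a × b) e V.conjTranspose) := by
  ext p q
  refine Finset.sum_congr rfl fun z _ => ?_
  rw [kroneckerOne_apply, kroneckerOne_apply, mul_kroneckerOne_apply, Matrix.mul_apply]
  refine Finset.sum_congr rfl fun w _ => ?_
  rw [kroneckerOne_mul_apply]
  rfl

theorem Matrix.PosSemidef.traceMiddle {X : Matrix ((a × b) × e) ((a × b) × e) ℂ}
    (hX : X.PosSemidef) : (traceMiddle X).PosSemidef := by
  have h : _root_.traceMiddle X = ∑ z, X.submatrix (fun p : a × e => ((p.1, z), p.2))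
      (fun p : a × e => ((p.1, z), p.2)) := by
    ext p q
    simp [_root_.traceMiddle, Matrix.sum_apply]
  rw [h]
  exact Matrix.posSemidef_sum _ fun z _ => hX.submatrix _

theorem isQuantumChannel_conjTrace {V : Matrix (a × b) (a × b) ℂ}
    (hV : V ∈ unitary (Matrix (a × b) (a × b) ℂ)) : IsQuantumChannel (conjTrace V) := by
  refine ⟨fun m X hX => ?_, fun X => ?_⟩
  · rw [tensorId_conjTrace]
    refine Matrix.PosSemidef.traceMiddle ?_
    rw [← Matrix.star_eq_conjTranspose, map_star]
    exact hX.mul_mul_conjTranspose_same _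
  · have h : (conjTrace V X).trace = (V * X * star V).trace := by
      rw [Matrix.trace, Matrix.trace, Fintype.sum_prod_type]
      rfl
    rw [h, Matrix.trace_mul_comm, ← Matrix.mul_assoc, (Unitary.mem_iff.1 hV).1, Matrix.one_mul]

end Channels

/-! ### Composition and repetition of algorithms -/

section Algorithms

variable {A B : Type} [Fintype A] [DecidableEq A] [Fintype B] [DecidableEq B] {K : ℕ}

theorem jointState_sum_smul {ι : Type} (s : Finset ι) (w : ι → ℂ) (ρ : Fin K → Matrix A A ℂ)
    {n : ℕ} (l : Fin n → Fin K) (σ : ι → Matrix (A × B) (A × B) ℂ) :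
    jointState ρ l (∑ i ∈ s, w i • σ i) = ∑ i ∈ s, w i • jointState ρ l (σ i) := by
  ext p q
  simp [jointState, Matrix.sum_apply, Finset.sum_mul, mul_assoc]

/-- Appending registers to a list of registers. -/
def appendRegisters (A : Type) (m n : ℕ) :
    (A × (Fin m → A)) × (Fin n → A) ≃ A × (Fin (m + n) → A) :=
  (Equiv.prodAssoc _ _ _).trans ((Equiv.refl A).prodCongr (Fin.appendEquiv m n))

namespace SampleAlgorithm

/-- The algorithm that runs `P` and then `Q`. -/
def comp (P Q : SampleAlgorithm A K) : SampleAlgorithm A K where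
  Outcome := P.Outcome × Q.Outcome
  prob ω := P.prob ω.1 * Q.prob ω.2
  prob_nonneg ω := mul_nonneg (P.prob_nonneg _) (Q.prob_nonneg _)
  prob_sum := by
    rw [Fintype.sum_prod_type, ← Finset.sum_mul_sum, P.prob_sum, Q.prob_sum, one_mul]
  samples ω := P.samples ω.1 + Q.samples ω.2
  label ω := Fin.append (P.label ω.1) (Q.label ω.2)
  channel ω := Q.channel ω.2 ∘ₗ tensorIdLinear (P.channel ω.1) (Fin (Q.samples ω.2) → A) ∘ₗ
    relabel (appendRegisters A (P.samples ω.1) (Q.samples ω.2))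
  isQuantumChannel ω := (Q.isQuantumChannel ω.2).comp
    (((P.isQuantumChannel ω.1).tensorIdLinear _).comp (isQuantumChannel_relabel _))

/-- The samples reserved for `Q` are spectators while `P` acts: at fixed indices they contribute a
scalar factor, which passes through the channel of `P` by linearity. -/
theorem tensorId_comp_channel (P Q : SampleAlgorithm A K) (ω : P.Outcome × Q.Outcome)
    (ρ : Fin K → Matrix A A ℂ) (σ : Matrix (A × B) (A × B) ℂ) :
    tensorId ((P.comp Q).channel ω) B (jointState ρ ((P.comp Q).label ω) σ)
      = tensorId (Q.channel ω.2) B (jointState ρ (Q.label ω.2)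
          (tensorId (P.channel ω.1) B (jointState ρ (P.label ω.1) σ))) := by
  ext p q
  refine congrFun₂ (congrArg (Q.channel ω.2) ?_) p.1 q.1
  ext x y
  have h : (Matrix.of fun u v => σ (u.1, p.2) (v.1, q.2) *
        ∏ i, ρ (Fin.append (P.label ω.1) (Q.label ω.2) i) (Fin.append u.2 x.2 i)
          (Fin.append v.2 y.2 i))
      = (∏ i, ρ (Q.label ω.2 i) (x.2 i) (y.2 i)) •
        (Matrix.of fun u v => jointState ρ (P.label ω.1) σ (u, p.2) (v, q.2)) := by
    ext u v
    simp only [Matrix.of_apply, Matrix.smul_apply, jointState, Fin.prod_univ_add,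
      Fin.append_left, Fin.append_right, smul_eq_mul]
    ring
  refine (congrFun₂ ((congrArg (P.channel ω.1) h).trans (map_smul _ _ _)) x.1 y.1).trans ?_
  rw [Matrix.smul_apply, smul_eq_mul, mul_comm]
  rfl

theorem output_comp (P Q : SampleAlgorithm A K) (ρ : Fin K → Matrix A A ℂ)
    (σ : Matrix (A × B) (A × B) ℂ) :
    (P.comp Q).output ρ σ = Q.output ρ (P.output ρ σ) := by
  have h : ∀ ω', tensorId (Q.channel ω') B (jointState ρ (Q.label ω') (P.output ρ σ))
      = ∑ ω, (P.prob ω : ℂ) • tensorId (Q.channel ω') B (jointState ρ (Q.label ω')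
          (tensorId (P.channel ω) B (jointState ρ (P.label ω) σ))) := fun ω' => by
    unfold output
    rw [jointState_sum_smul]
    refine (map_sum (tensorIdLinear (Q.channel ω') B) _ _).trans ?_
    exact Finset.sum_congr rfl fun ω _ => map_smul (tensorIdLinear (Q.channel ω') B) _ _
  rw [output, output]
  simp only [h, Finset.smul_sum]
  rw [Finset.sum_comm]
  refine (Fintype.sum_prod_type _).trans ?_
  refine Finset.sum_congr rfl fun ω _ => Finset.sum_congr rfl fun ω' _ => ?_
  rw [tensorId_comp_channel, smul_smul, ← Complex.ofReal_mul, mul_comm (Q.prob ω')]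
  rfl

theorem averageUses_comp (P Q : SampleAlgorithm A K) (j : Fin K) :
    (P.comp Q).averageUses j = P.averageUses j + Q.averageUses j := by
  have h : ∀ ω : P.Outcome × Q.Outcome,
      ((Finset.univ.filter fun i => (P.comp Q).label ω i = j).card : ℝ)
        = (Finset.univ.filter fun i => P.label ω.1 i = j).card
          + (Finset.univ.filter fun i => Q.label ω.2 i = j).card := fun ω => by
    rw [← Nat.cast_add]
    congr 1
    simp only [Finset.card_filter]
    refine (Fin.sum_univ_add _).trans ?_
    simp [comp]
  unfold averageUses
  calc ∑ ω, (P.comp Q).prob ω * ((Finset.univ.filter fun i => (P.comp Q).label ω i = j).card : ℝ)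
      = ∑ ω : P.Outcome × Q.Outcome, (P.prob ω.1 * Q.prob ω.2) *
        ((Finset.univ.filter fun i => P.label ω.1 i = j).card
          + (Finset.univ.filter fun i => Q.label ω.2 i = j).card : ℝ) :=
        Finset.sum_congr rfl fun ω _ => congrArg ((P.comp Q).prob ω * ·) (h ω)
    _ = ∑ ω, ∑ ω', ((P.prob ω * (Finset.univ.filter fun i => P.label ω i = j).card) * Q.prob ω'
        + P.prob ω * (Q.prob ω' * (Finset.univ.filter fun i => Q.label ω' i = j).card)) := by
        rw [Fintype.sum_prod_type]
        exact Finset.sum_congr rfl fun ω _ => Finset.sum_congr rfl fun ω' _ => by ring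
    _ = _ := by
        simp only [Finset.sum_add_distrib, ← Finset.mul_sum, ← Finset.sum_mul, P.prob_sum,
          Q.prob_sum, mul_one, one_mul]

/-- The algorithm that does nothing. -/
def idle (A : Type) [Fintype A] [DecidableEq A] (K : ℕ) : SampleAlgorithm A K where
  Outcome := Unit
  prob _ := 1
  prob_nonneg _ := zero_le_one
  prob_sum := by simp
  samples _ := 0
  label _ := Fin.elim0
  channel _ := relabel (Equiv.prodUnique A (Fin 0 → A)).symm
  isQuantumChannel _ := isQuantumChannel_relabel _

theorem output_idle (ρ : Fin K → Matrix A A ℂ) (σ : Matrix (A × B) (A × B) ℂ) :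
    (idle A K).output ρ σ = σ := by
  have h : tensorId ((idle A K).channel ()) B (jointState ρ ((idle A K).label ()) σ) = σ := by
    ext p q
    change σ p q * ∏ i : Fin 0, _ = σ p q
    rw [Fin.prod_univ_zero, mul_one]
  refine (Fintype.sum_unique (ι := Unit) _).trans ?_
  change ((1 : ℝ) : ℂ) • tensorId ((idle A K).channel ()) B
    (jointState ρ ((idle A K).label ()) σ) = σ
  rw [h, Complex.ofReal_one, one_smul]

theorem averageUses_idle (j : Fin K) : (idle A K).averageUses j = 0 := by
  refine Finset.sum_eq_zero fun ω _ => ?_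
  rw [Finset.card_eq_zero.2, Nat.cast_zero, mul_zero]
  exact Finset.filter_eq_empty_iff.2 fun i => i.elim0

/-- The `n`-fold repetition of an algorithm. -/
def iterate (P : SampleAlgorithm A K) : ℕ → SampleAlgorithm A K
  | 0 => idle A K
  | n + 1 => (P.iterate n).comp P

theorem averageUses_iterate (P : SampleAlgorithm A K) (n : ℕ) (j : Fin K) :
    (P.iterate n).averageUses j = n * P.averageUses j := by
  induction n with
  | zero => rw [iterate, averageUses_idle, Nat.cast_zero, zero_mul]
  | succ n ih =>
    rw [iterate, averageUses_comp, ih]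
    push_cast
    ring

theorem samples_iterate_le (P : SampleAlgorithm A K) {L : ℕ} (hP : ∀ ω, P.samples ω ≤ L) (n : ℕ) :
    ∀ ω, (P.iterate n).samples ω ≤ L * n := by
  induction n with
  | zero => exact fun _ => le_rfl
  | succ n ih => exact fun ω => (add_le_add (ih ω.1) (hP ω.2)).trans_eq (Nat.mul_succ L n).symm

end SampleAlgorithm

end Algorithms

/-! ### Density matrices are preserved -/

section States

variable {A B : Type} [Fintype A] [DecidableEq A] [Fintype B] [DecidableEq B] {K : ℕ}

/-- The joint state is an entrywise product of positive semidefinite matrices pulled back to the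
joint index set, so the Schur product theorem applies one sample at a time. -/
theorem jointState_posSemidef {ρ : Fin K → Matrix A A ℂ} (hρ : ∀ j, (ρ j).PosSemidef) {n : ℕ}
    (l : Fin n → Fin K) {σ : Matrix (A × B) (A × B) ℂ} (hσ : σ.PosSemidef) :
    (jointState ρ l σ).PosSemidef := by
  have h : ∀ s : Finset (Fin n), (Matrix.of fun p q : (A × (Fin n → A)) × B =>
      σ (p.1.1, p.2) (q.1.1, q.2) * ∏ i ∈ s, ρ (l i) (p.1.2 i) (q.1.2 i)).PosSemidef := by
    intro s
    induction s using Finset.induction_on with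
    | empty =>
      simp only [Finset.prod_empty, mul_one]
      exact hσ.submatrix fun p : (A × (Fin n → A)) × B => (p.1.1, p.2)
    | insert i s hi ih =>
      have h1 := ih.hadamard ((hρ (l i)).submatrix fun p : (A × (Fin n → A)) × B => p.1.2 i)
      have h2 : (Matrix.of fun p q : (A × (Fin n → A)) × B => σ (p.1.1, p.2) (q.1.1, q.2) *
            ∏ k ∈ insert i s, ρ (l k) (p.1.2 k) (q.1.2 k))
          = (Matrix.of fun p q : (A × (Fin n → A)) × B => σ (p.1.1, p.2) (q.1.1, q.2) *
            ∏ k ∈ s, ρ (l k) (p.1.2 k) (q.1.2 k)).hadamard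
              ((ρ (l i)).submatrix (fun p => p.1.2 i) fun p => p.1.2 i) := by
        ext p q
        simp only [Matrix.of_apply, Finset.prod_insert hi, Matrix.hadamard_apply,
          Matrix.submatrix_apply]
        ring
      rw [h2]
      exact h1
  exact h Finset.univ

theorem traceMiddle_jointState {ρ : Fin K → Matrix A A ℂ} (hρ : ∀ j, (ρ j).trace = 1) {n : ℕ}
    (l : Fin n → Fin K) (σ : Matrix (A × B) (A × B) ℂ) : traceMiddle (jointState ρ l σ) = σ := by
  ext p q
  have h : ∑ z : Fin n → A, ∏ i, ρ (l i) (z i) (z i) = 1 := by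
    refine (Fintype.prod_sum fun i x => ρ (l i) x x).symm.trans ?_
    exact Finset.prod_eq_one fun i _ => hρ (l i)
  simp only [traceMiddle, jointState, Matrix.of_apply, ← Finset.mul_sum]
  rw [h, mul_one]

theorem trace_traceMiddle {Z : Type} [Fintype Z] (X : Matrix ((A × Z) × B) ((A × Z) × B) ℂ) :
    (traceMiddle X).trace = X.trace := by
  simp only [Matrix.trace, Fintype.sum_prod_type, traceMiddle, Matrix.diag, Matrix.of_apply]
  exact Finset.sum_congr rfl fun _ _ => Finset.sum_comm

theorem IsDensityMatrix.jointState {ρ : Fin K → Matrix A A ℂ} (hρ : ∀ j, IsDensityMatrix (ρ j))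
    {n : ℕ} (l : Fin n → Fin K) {σ : Matrix (A × B) (A × B) ℂ} (hσ : IsDensityMatrix σ) :
    IsDensityMatrix (jointState ρ l σ) :=
  ⟨jointState_posSemidef (fun j => (hρ j).1) l hσ.1, by
    rw [← trace_traceMiddle, traceMiddle_jointState (fun j => (hρ j).2), hσ.2]⟩

theorem IsDensityMatrix.output {ρ : Fin K → Matrix A A ℂ} (hρ : ∀ j, IsDensityMatrix (ρ j))
    (P : SampleAlgorithm A K) {σ : Matrix (A × B) (A × B) ℂ} (hσ : IsDensityMatrix σ) :
    IsDensityMatrix (P.output ρ σ) := by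
  refine ⟨Matrix.posSemidef_sum _ fun ω _ => ?_, ?_⟩
  · exact ((P.isQuantumChannel ω).posSemidef_tensorId (hσ.jointState hρ _).1).smul
      (Complex.zero_le_real.2 (P.prob_nonneg ω))
  · have h : ∀ ω, (tensorId (P.channel ω) B (_root_.jointState ρ (P.label ω) σ)).trace = 1 :=
      fun ω => (((P.isQuantumChannel ω).tensorIdLinear B).2 _).trans (hσ.jointState hρ _).2
    simp only [SampleAlgorithm.output, Matrix.trace_sum, Matrix.trace_smul, h, smul_eq_mul, mul_one]
    rw [← Complex.ofReal_sum, P.prob_sum, Complex.ofReal_one]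

end States

/-! ### Simulating one monomial -/

section Monomials

variable {A B : Type} [Fintype A] [DecidableEq A] [Fintype B] [DecidableEq B] {K : ℕ}

/-- `(e^{iφ} S + e^{-iφ} S†) / 2` for the cyclic shift `S`. -/
noncomputable def cyclicHamiltonian (A : Type) [Fintype A] [DecidableEq A] (φ : ℝ) (k : ℕ) :
    Matrix (A × (Fin k → A)) (A × (Fin k → A)) ℂ :=
  (1 / 2 : ℂ) • (Complex.exp (Complex.I * φ) • (cyclicShift A k).permMatrix ℂ +
    Complex.exp (-(Complex.I * φ)) • (cyclicShift A k)⁻¹.permMatrix ℂ)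

theorem star_exp_I_mul (φ : ℝ) :
    star (Complex.exp (Complex.I * φ)) = Complex.exp (-(Complex.I * φ)) := by
  rw [Complex.star_def, ← Complex.exp_conj]
  simp

theorem star_exp_neg_I_mul (φ : ℝ) :
    star (Complex.exp (-(Complex.I * φ))) = Complex.exp (Complex.I * φ) := by
  rw [← star_exp_I_mul, star_star]

theorem norm_exp_I_mul (φ : ℝ) : ‖Complex.exp (Complex.I * φ)‖ = 1 := by
  rw [mul_comm, Complex.norm_exp_ofReal_mul_I]

theorem norm_exp_neg_I_mul (φ : ℝ) : ‖Complex.exp (-(Complex.I * φ))‖ = 1 := by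
  rw [← star_exp_I_mul, norm_star, norm_exp_I_mul]

/-- A phase-weighted average of two matrices that are adjoint to each other. -/
theorem isHermitian_phase_average {n : Type} {X Y : Matrix n n ℂ} (h : X.conjTranspose = Y)
    (φ : ℝ) :
    ((1 / 2 : ℂ) • (Complex.exp (Complex.I * φ) • X
      + Complex.exp (-(Complex.I * φ)) • Y)).IsHermitian := by
  subst h
  rw [Matrix.IsHermitian, Matrix.conjTranspose_smul, Matrix.conjTranspose_add,
    Matrix.conjTranspose_smul, Matrix.conjTranspose_smul, Matrix.conjTranspose_conjTranspose,
    star_exp_I_mul, star_exp_neg_I_mul, add_comm]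
  simp

theorem norm_phase_average_le {n : Type} [Fintype n] [DecidableEq n] {X Y : Matrix n n ℂ}
    (hX : ‖X‖ ≤ 1) (hY : ‖Y‖ ≤ 1) (φ : ℝ) :
    ‖(1 / 2 : ℂ) • (Complex.exp (Complex.I * φ) • X
      + Complex.exp (-(Complex.I * φ)) • Y)‖ ≤ 1 := by
  rw [norm_smul]
  have h := norm_add_le (Complex.exp (Complex.I * φ) • X) (Complex.exp (-(Complex.I * φ)) • Y)
  rw [norm_smul, norm_smul, norm_exp_I_mul, norm_exp_neg_I_mul, one_mul, one_mul] at h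
  norm_num
  linarith

theorem cyclicHamiltonian_isHermitian (φ : ℝ) (k : ℕ) : (cyclicHamiltonian A φ k).IsHermitian :=
  isHermitian_phase_average (Matrix.conjTranspose_permMatrix _) φ

theorem norm_cyclicHamiltonian_le (φ : ℝ) (k : ℕ) : ‖cyclicHamiltonian A φ k‖ ≤ 1 :=
  norm_phase_average_le (Matrix.permMatrix_l2_opNorm_le _) (Matrix.permMatrix_l2_opNorm_le _) φ

theorem conjTranspose_list_map_prod {ρ : Fin K → Matrix A A ℂ} (hρ : ∀ j, (ρ j).IsHermitian)
    (r : List (Fin K)) : (r.map ρ).prod.conjTranspose = (r.reverse.map ρ).prod := by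
  rw [Matrix.conjTranspose_list_prod, List.map_map, List.map_reverse]
  congr 2
  exact List.map_congr_left fun j _ => hρ j

theorem norm_list_map_prod_le {ρ : Fin K → Matrix A A ℂ} (hρ : ∀ j, ‖ρ j‖ ≤ 1)
    (r : List (Fin K)) : ‖(r.map ρ).prod‖ ≤ 1 := by
  induction r with
  | nil => exact norm_le_one_of_mem_unitary (one_mem _)
  | cons j r ih =>
    rw [List.map_cons, List.prod_cons]
    exact (norm_mul_le _ _).trans (mul_le_one₀ (hρ j) (norm_nonneg _) ih)

theorem hermitianMonomial_isHermitian {ρ : Fin K → Matrix A A ℂ} (hρ : ∀ j, (ρ j).IsHermitian)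
    (φ : ℝ) (r : List (Fin K)) : (hermitianMonomial ρ φ r).IsHermitian :=
  isHermitian_phase_average (conjTranspose_list_map_prod hρ r) φ

theorem norm_hermitianMonomial_le {ρ : Fin K → Matrix A A ℂ} (hρ : ∀ j, ‖ρ j‖ ≤ 1)
    (φ : ℝ) (r : List (Fin K)) : ‖hermitianMonomial ρ φ r‖ ≤ 1 :=
  norm_phase_average_le (norm_list_map_prod_le hρ r) (norm_list_map_prod_le hρ r.reverse) φ

theorem hermitianPolynomial_isHermitian (R : Finset (List (Fin K))) (c φ : List (Fin K) → ℝ)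
    {ρ : Fin K → Matrix A A ℂ} (hρ : ∀ j, (ρ j).IsHermitian) :
    (hermitianPolynomial R c φ ρ).IsHermitian := by
  rw [Matrix.IsHermitian, hermitianPolynomial, Matrix.conjTranspose_sum]
  refine Finset.sum_congr rfl fun r _ => ?_
  rw [Matrix.conjTranspose_smul, (hermitianMonomial_isHermitian hρ _ _).eq, Complex.star_def,
    Complex.conj_ofReal]

theorem norm_hermitianPolynomial_le (R : Finset (List (Fin K))) (c φ : List (Fin K) → ℝ)
    {ρ : Fin K → Matrix A A ℂ} (hρ : ∀ j, ‖ρ j‖ ≤ 1) :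
    ‖hermitianPolynomial R c φ ρ‖ ≤ coeffSum R c := by
  refine norm_sum_le_of_le _ fun r _ => ?_
  rw [norm_smul, Complex.norm_real, Real.norm_eq_abs]
  exact mul_le_of_le_one_right (abs_nonneg _) (norm_hermitianMonomial_le hρ _ _)

theorem traceMiddle_cyclicHamiltonian_mul (ρ : Fin K → Matrix A A ℂ) (φ : ℝ) (r : List (Fin K))
    (σ : Matrix (A × B) (A × B) ℂ) :
    traceMiddle (kroneckerOne (A × (Fin r.length → A)) B (cyclicHamiltonian A φ r.length)
        * jointState ρ r.get σ) = kroneckerOne A B (hermitianMonomial ρ φ r) * σ := by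
  have h : (List.ofFn fun i => ρ (r.get i)) = r.map ρ := by
    rw [← Function.comp_def, ← List.map_ofFn, List.ofFn_get]
  rw [cyclicHamiltonian, hermitianMonomial]
  simp only [map_smul, map_add, Matrix.smul_mul, Matrix.add_mul, traceMiddle_smul, traceMiddle_add,
    traceMiddle_cyclicShift_mul_jointState, traceMiddle_cyclicShift_inv_mul_jointState, h,
    List.map_reverse]

theorem traceMiddle_commutator {ρ : Fin K → Matrix A A ℂ} (hρ : ∀ j, (ρ j).PosSemidef) (φ : ℝ)
    (r : List (Fin K)) {σ : Matrix (A × B) (A × B) ℂ} (hσ : σ.PosSemidef) :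
    traceMiddle (kroneckerOne (A × (Fin r.length → A)) B (cyclicHamiltonian A φ r.length)
        * jointState ρ r.get σ - jointState ρ r.get σ
          * kroneckerOne (A × (Fin r.length → A)) B (cyclicHamiltonian A φ r.length))
      = kroneckerOne A B (hermitianMonomial ρ φ r) * σ
        - σ * kroneckerOne A B (hermitianMonomial ρ φ r) := by
  have hG : (kroneckerOne (A × (Fin r.length → A)) B
      (cyclicHamiltonian A φ r.length)).conjTranspose
      = kroneckerOne (A × (Fin r.length → A)) B (cyclicHamiltonian A φ r.length) := by
    rw [← Matrix.star_eq_conjTranspose, ← map_star, Matrix.star_eq_conjTranspose,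
      (cyclicHamiltonian_isHermitian φ _).eq]
  have hH : (kroneckerOne A B (hermitianMonomial ρ φ r)).conjTranspose
      = kroneckerOne A B (hermitianMonomial ρ φ r) := by
    rw [← Matrix.star_eq_conjTranspose, ← map_star, Matrix.star_eq_conjTranspose,
      (hermitianMonomial_isHermitian (fun j => (hρ j).1) φ r).eq]
  have h1 := traceMiddle_cyclicHamiltonian_mul ρ φ r σ
  -- All factors are Hermitian, so taking adjoints of the identity for left multiplication gives the
  -- one for right multiplication.
  have h2 := congrArg Matrix.conjTranspose h1
  rw [← traceMiddle_conjTranspose, Matrix.conjTranspose_mul, Matrix.conjTranspose_mul, hG, hH,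
    hσ.1.eq, (jointState_posSemidef hρ r.get hσ).1.eq] at h2
  rw [traceMiddle_sub, h1, h2]

/-- The first-order effect on a state of one simulation step for a single monomial. -/
theorem traceBounded_monomialStep {ρ : Fin K → Matrix A A ℂ} (hρ : ∀ j, IsDensityMatrix (ρ j))
    (φ : ℝ) (r : List (Fin K)) {σ : Matrix (A × B) (A × B) ℂ} (hσ : IsDensityMatrix σ)
    {x g : ℝ} (hx : |x| ≤ g) :
    TraceBounded (tensorId (conjTrace (evolution (cyclicHamiltonian A φ r.length) x)) B
        (jointState ρ r.get σ) - σ - (-(Complex.I * x)) •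
          (kroneckerOne A B (hermitianMonomial ρ φ r) * σ
            - σ * kroneckerOne A B (hermitianMonomial ρ φ r))) (4 * g ^ 2) := by
  have hG := cyclicHamiltonian_isHermitian (A := A) φ r.length
  have h := (TraceBounded.evolvedState_remainder hG (t := x) (g := g)
    ((mul_le_of_le_one_right (abs_nonneg x) (norm_cyclicHamiltonian_le φ _)).trans hx)
    (hσ.jointState hρ r.get).traceBounded).traceMiddle (by positivity)
  rw [traceMiddle_sub, traceMiddle_sub, traceMiddle_smul,
    traceMiddle_commutator (fun j => (hρ j).1) φ r hσ.1,
    traceMiddle_jointState (fun j => (hρ j).2), evolvedState_eq, ← star_evolution hG,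
    Matrix.star_eq_conjTranspose, ← tensorId_conjTrace] at h
  exact h

end Monomials

/-! ### The randomized step and its iteration -/

section Simulation

variable {A B : Type} [Fintype A] [DecidableEq A] [Fintype B] [DecidableEq B] {K : ℕ}

/-- One step of the simulation, of duration `τ`: a monomial is drawn with probability proportional
to the absolute value of its coefficient, and the corresponding cyclic Hamiltonian is applied to the
system and the samples. -/
noncomputable def simulationStep (A : Type) [Fintype A] [DecidableEq A]
    (R : Finset (List (Fin K))) (c φ : List (Fin K) → ℝ) (hc : 0 < coeffSum R c) (τ : ℝ) :
    SampleAlgorithm A K where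
  Outcome := R
  prob r := |c r| / coeffSum R c
  prob_nonneg r := div_nonneg (abs_nonneg _) hc.le
  prob_sum := by
    rw [Finset.sum_coe_sort R fun r => |c r| / coeffSum R c, ← Finset.sum_div]
    exact div_self hc.ne'
  samples r := r.1.length
  label r := r.1.get
  channel r := conjTrace (evolution (cyclicHamiltonian A (φ r) r.1.length)
    (SignType.sign (c r) * coeffSum R c * τ))
  isQuantumChannel r := isQuantumChannel_conjTrace
    (evolution_mem_unitary (cyclicHamiltonian_isHermitian _ _) _)

variable (R : Finset (List (Fin K))) (c φ : List (Fin K) → ℝ) (hc : 0 < coeffSum R c)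

theorem samples_simulationStep_le (τ : ℝ) (ω : (simulationStep A R c φ hc τ).Outcome) :
    (simulationStep A R c φ hc τ).samples ω ≤ polyDegree R :=
  Finset.le_sup (f := List.length) ω.2

theorem averageUses_simulationStep (τ : ℝ) (j : Fin K) :
    (simulationStep A R c φ hc τ).averageUses j = averageMultiplicity R c j := by
  have h : ∀ r : List (Fin K), (Finset.univ.filter fun i => r.get i = j).card = r.count j := by
    intro r
    rw [Finset.card_filter]
    induction r with
    | nil => rfl
    | cons x r ih =>
      refine (Fin.sum_univ_succ _).trans ?_
      rw [List.count_cons, ← ih, add_comm]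
      by_cases h : x = j <;> simp [h]
  refine (Finset.sum_coe_sort R fun r => |c r| / coeffSum R c *
    ((Finset.univ.filter fun i => r.get i = j).card : ℝ)).trans ?_
  refine Finset.sum_congr rfl fun r _ => ?_
  rw [h]
  ring

/-- The exact and the simulated step share the term `-iτ[H, σ]`; the constant is `8 = 4 + 4`, one
remainder from each. -/
theorem traceBounded_simulationStep {ρ : Fin K → Matrix A A ℂ} (hρ : ∀ j, IsDensityMatrix (ρ j))
    (τ : ℝ) {σ : Matrix (A × B) (A × B) ℂ} (hσ : IsDensityMatrix σ) :
    TraceBounded (evolvedState (hermitianPolynomial R c φ ρ) τ σ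
      - (simulationStep A R c φ hc τ).output ρ σ) (8 * (coeffSum R c * |τ|) ^ 2) := by
  set H := hermitianPolynomial R c φ ρ with hHdef
  have hH : H.IsHermitian := hermitianPolynomial_isHermitian R c φ fun j => (hρ j).1.1
  have h1 := TraceBounded.evolvedState_remainder hH (t := τ) (g := coeffSum R c * |τ|)
    (by
      rw [mul_comm]
      gcongr
      exact norm_hermitianPolynomial_le R c φ fun j => (hρ j).norm_le_one)
    hσ.traceBounded
  let x : List (Fin K) → ℝ := fun r => SignType.sign (c r) * coeffSum R c * τ
  let D : List (Fin K) → Matrix (A × B) (A × B) ℂ := fun r =>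
    kroneckerOne A B (hermitianMonomial ρ (φ r) r) * σ
      - σ * kroneckerOne A B (hermitianMonomial ρ (φ r) r)
  let T : List (Fin K) → Matrix (A × B) (A × B) ℂ := fun r =>
    tensorId (conjTrace (evolution (cyclicHamiltonian A (φ r) r.length) (x r))) B
      (jointState ρ r.get σ)
  let w : List (Fin K) → ℝ := fun r => |c r| / coeffSum R c
  have hw : ∑ r ∈ R, w r = 1 := by
    rw [← Finset.sum_div]
    exact div_self hc.ne'
  have hx : ∀ r, |x r| ≤ coeffSum R c * |τ| := fun r => by
    have hs : |((SignType.sign (c r) : SignType) : ℝ)| ≤ 1 := by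
      rcases lt_trichotomy (c r) 0 with h | h | h <;> simp [h]
    simp only [x]
    rw [abs_mul, abs_mul, abs_of_pos hc, mul_assoc]
    exact mul_le_of_le_one_left (by positivity) hs
  have h2 := TraceBounded.sum R fun r _ =>
    (traceBounded_monomialStep hρ (φ r) r hσ (hx r)).smul (w r : ℂ)
  have hout : (simulationStep A R c φ hc τ).output ρ σ = ∑ r ∈ R, (w r : ℂ) • T r :=
    Finset.sum_coe_sort R fun r => (w r : ℂ) • T r
  have hcomm : kroneckerOne A B H * σ - σ * kroneckerOne A B H = ∑ r ∈ R, (c r : ℂ) • D r := by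
    rw [hHdef, hermitianPolynomial, map_sum, Finset.sum_mul, Finset.mul_sum,
      ← Finset.sum_sub_distrib]
    refine Finset.sum_congr rfl fun r _ => ?_
    rw [map_smul, Matrix.smul_mul, Matrix.mul_smul, ← smul_sub]
  -- Probability times evolution time recovers the signed coefficient: the sign of `c_r`, absent
  -- from the probability, is carried by the time.
  have hwx : ∀ r, w r * x r = c r * τ := fun r => by
    simp only [w, x]
    rw [show |c r| / coeffSum R c * (SignType.sign (c r) * coeffSum R c * τ)
      = (SignType.sign (c r) * |c r|) * τ * (coeffSum R c / coeffSum R c) by ring,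
      sign_mul_abs, div_self hc.ne', mul_one]
  have hsum : ∑ r ∈ R, (w r : ℂ) • (T r - σ - (-(Complex.I * x r)) • D r)
      = (simulationStep A R c φ hc τ).output ρ σ - σ
        - (-(Complex.I * τ)) • (kroneckerOne A B H * σ - σ * kroneckerOne A B H) := by
    rw [hout, hcomm]
    simp only [smul_sub, Finset.sum_sub_distrib, ← Finset.sum_smul, Finset.smul_sum, smul_smul]
    rw [← Complex.ofReal_sum, hw, Complex.ofReal_one, one_smul]
    congr 1
    refine Finset.sum_congr rfl fun r _ => ?_
    congr 1
    have := congrArg (fun y : ℝ => (y : ℂ)) (hwx r)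
    push_cast at this
    linear_combination (-Complex.I) * this
  have hbound : ∑ r ∈ R, ‖(w r : ℂ)‖ * (4 * (coeffSum R c * |τ|) ^ 2)
      = 4 * (coeffSum R c * |τ|) ^ 2 := by
    have hn : ∀ r, ‖(w r : ℂ)‖ = w r := fun r => by
      rw [Complex.norm_real, Real.norm_of_nonneg (div_nonneg (abs_nonneg _) hc.le)]
    simp only [hn]
    rw [← Finset.sum_mul, hw, one_mul]
  rw [hbound] at h2
  have h3 := h1.sub (hsum ▸ h2)
  convert h3 using 1
  · abel
  · ring

/-- Telescoping: the exact step, being a unitary conjugation, does not enlarge the error made so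
far, and the one-step bound applies to the current output because it is again a density matrix. -/
theorem traceBounded_iterate_simulationStep {ρ : Fin K → Matrix A A ℂ}
    (hρ : ∀ j, IsDensityMatrix (ρ j)) (τ : ℝ) {σ : Matrix (A × B) (A × B) ℂ}
    (hσ : IsDensityMatrix σ) (n : ℕ) :
    TraceBounded (evolvedState (hermitianPolynomial R c φ ρ) (n * τ) σ
      - ((simulationStep A R c φ hc τ).iterate n).output ρ σ)
      (n * (8 * (coeffSum R c * |τ|) ^ 2)) := by
  have hH := hermitianPolynomial_isHermitian R c φ fun j => (hρ j).1.1
  induction n with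
  | zero =>
    rw [SampleAlgorithm.iterate, SampleAlgorithm.output_idle, Nat.cast_zero, zero_mul, zero_mul,
      evolvedState_zero, sub_self]
    exact TraceBounded.zero
  | succ n ih =>
    rw [SampleAlgorithm.iterate, SampleAlgorithm.output_comp,
      show ((n + 1 : ℕ) : ℝ) * τ = τ + n * τ by push_cast; ring, evolvedState_add]
    have h1 := TraceBounded.evolvedState hH τ (by positivity) ih
    have h2 := traceBounded_simulationStep R c φ hc hρ τ
      (hσ.output hρ ((simulationStep A R c φ hc τ).iterate n))
    have h3 := h1.add h2
    rw [evolvedState_sub] at h3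
    convert h3 using 1
    · abel
    · push_cast
      ring

end Simulation

/-! ### Choice of the number of steps -/

theorem mainTheorem4 :
    ∃ C : ℝ, 0 < C ∧
      ∀ (A : Type) [Fintype A] [DecidableEq A] (K : ℕ)
        (R : Finset (List (Fin K))) (c φ : List (Fin K) → ℝ) (t δ : ℝ), 0 < δ →
        ∃ P : SampleAlgorithm A K,
          (∀ ρ : Fin K → Matrix A A ℂ, (∀ j, IsDensityMatrix (ρ j)) →
            ∀ (B : Type) [Fintype B] [DecidableEq B] (σ : Matrix (A × B) (A × B) ℂ),
              IsDensityMatrix σ →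
                1 / 2 * traceNorm
                  (evolvedState (hermitianPolynomial R c φ ρ) t σ - P.output ρ σ) ≤ δ) ∧
          (∀ ω, P.samples ω ≤ polyDegree R * ⌈C * (coeffSum R c ^ 2 * t ^ 2 / δ)⌉₊) ∧
          (∀ j, P.averageUses j ≤
            averageMultiplicity R c j * ⌈C * (coeffSum R c ^ 2 * t ^ 2 / δ)⌉₊) := by
  -- The constant is half of the `8` in the accumulated error `8 c²t² / N`.
  refine ⟨4, by norm_num, fun A _ _ K R c φ t δ hδ => ?_⟩
  have hc0 : 0 ≤ coeffSum R c := Finset.sum_nonneg fun r _ => abs_nonneg _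
  set N : ℕ := ⌈4 * (coeffSum R c ^ 2 * t ^ 2 / δ)⌉₊ with hN
  have hNle : 4 * (coeffSum R c ^ 2 * t ^ 2 / δ) ≤ N := Nat.le_ceil _
  -- Here the sample budget is zero, and nothing has to be simulated: either `t = 0`, or `c = 0` and
  -- `‖H‖ ≤ c` forces `H = 0`. Otherwise `N > 0`, so `t / N` is a genuine step length.
  by_cases h0 : coeffSum R c * t = 0
  · have hN0 : N = 0 := by
      rw [hN, ← mul_pow, h0]
      simp
    refine ⟨SampleAlgorithm.idle A K, fun ρ hρ B _ _ σ hσ => ?_, fun ω => Nat.zero_le _,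
      fun j => ?_⟩
    · have he : evolvedState (hermitianPolynomial R c φ ρ) t σ = σ := by
        rcases mul_eq_zero.1 h0 with h | h
        · have hH : hermitianPolynomial R c φ ρ = 0 := by
            rw [← norm_le_zero_iff, ← h]
            exact norm_hermitianPolynomial_le R c φ fun j => (hρ j).norm_le_one
          rw [hH, evolvedState_zero_left]
        · rw [h, evolvedState_zero]
      rw [he, SampleAlgorithm.output_idle, sub_self]
      linarith [TraceBounded.zero.traceNorm_le (a := A × B) le_rfl]
    · rw [SampleAlgorithm.averageUses_idle, hN0, Nat.cast_zero, mul_zero]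
  · have hc : 0 < coeffSum R c := hc0.lt_of_ne fun h => h0 (by rw [← h, zero_mul])
    have hpos : 0 < 4 * (coeffSum R c ^ 2 * t ^ 2 / δ) := by
      rw [← mul_pow]
      positivity
    have hNpos : (0 : ℝ) < N := hpos.trans_le hNle
    refine ⟨(simulationStep A R c φ hc (t / N)).iterate N, fun ρ hρ B _ _ σ hσ => ?_,
      SampleAlgorithm.samples_iterate_le _ (samples_simulationStep_le R c φ hc _) N,
      fun j => ?_⟩
    · have h := (traceBounded_iterate_simulationStep R c φ hc hρ (t / N) hσ N).traceNorm_le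
        (by positivity)
      rw [mul_div_cancel₀ t hNpos.ne'] at h
      have hval : (N : ℝ) * (8 * (coeffSum R c * |t / N|) ^ 2)
          = 8 * (coeffSum R c ^ 2 * t ^ 2) / N := by
        rw [mul_pow, sq_abs]
        field_simp
      have hle : 8 * (coeffSum R c ^ 2 * t ^ 2) / N ≤ 2 * δ := by
        rw [div_le_iff₀ hNpos]
        have := mul_le_mul_of_nonneg_left hNle hδ.le
        rw [show δ * (4 * (coeffSum R c ^ 2 * t ^ 2 / δ))
          = 4 * (coeffSum R c ^ 2 * t ^ 2) * (δ / δ) by ring, div_self hδ.ne', mul_one] at this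
        linarith
      linarith
    · rw [SampleAlgorithm.averageUses_iterate, averageUses_simulationStep, mul_comm]
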